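/- Theorem (Evaluation). Work in the polarised classical S4 sequent calculus $\mathbf{L}^{\Box}_{\mathrm{pol}}$, defined as follows. \textbf{Polarities and types.} Polarities are $\epsilon ::= + \mid - \mid \square$; $\boxplus$ stands for $+$ or $\square$. Put $\square\odot\square=\square$ and $\epsilon\odot\epsilon'=+$ otherwise. Types are $A,B ::= \mathbb 1 \mid A\otimes B\mid A\oplus B\mid \Box A\mid \neg A\mid A\,\&\,B\mid A \mathbin{\wp} B$, with polarity $\varpi(\mathbb 1)=\varpi(\Box A)=\square$, $\varpi(A\otimes B)=\varpi(A\oplus B)=\varpi(A)\odot\varpi(B)$, $\varpi(\neg A)=\varpi(A\& B)=\varpi(A \mathbin{\wp} B)=-$. A type is modal if $\varpi(A)=\square$; $A_\epsilon$ means that $\varpi(A)=\epsilon$. \textbf{Terms} (up to renaming of bound variables $x,y$ and covariables $\alpha,\beta$; $\mathrm{rec}$ denotes the lazy record and $\mathrm{case}$ the case analysis): values $V,W ::= x \mid (V,W)\mid \square V\mid ()\mid \iota_1V\mid\iota_2V\mid\mu[x^\epsilon].c\mid \mathrm{rec}(\alpha^{\epsilon_1}.c_1;\beta^{\epsilon_2}.c_2)\mid\mu(\alpha^{\epsilon_1},\beta^{\epsilon_2}).c\mid\mu\alpha^-.c$;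 co-values $S,S' ::= \alpha\mid\pi_1S\mid\pi_2S\mid\tilde\mu\square x^\epsilon.c\mid[V]\mid(S,S')\mid\tilde\mu().c\mid\tilde\mu x^{\boxplus}.c\mid\tilde\mu(x^{\epsilon_1},y^{\epsilon_2}).c\mid\mathrm{case}(x^{\epsilon_1}.c_1;y^{\epsilon_2}.c_2)$; expressions $t ::= V\mid\mu\alpha^{\boxplus}.c$; environments $e ::= S\mid\tilde\mu x^-.c$; commands $c ::= \langle t\|S\rangle^{\boxplus}\mid\langle V\|e\rangle^-$. \textbf{Toplevel reduction} $\vartriangleright$ (with capture-avoiding substitution, applied only to the whole command): $\langle\mu\alpha^\epsilon.c\|S\rangle^\epsilon\vartriangleright c[S/\alpha]$; $\langle V\|\tilde\mu x^\epsilon.c\rangle^\epsilon\vartriangleright c[V/x]$; $\langle()\|\tilde\mu().c\rangle^\square\vartriangleright c$; $\langle(V,W)\|\tilde\mu(x^{\epsilon_1},y^{\epsilon_2}).c\rangle^\epsilon\vartriangleright c[V/x,W/y]$; $\langle\iota_iV\|\mathrm{case}(x_1^{\epsilon_1}.c_1;x_2^{\epsilon_2}.c_2)\rangle^\epsilon\vartriangleright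 c_i[V/x_i]$; $\langle\square V\|\tilde\mu\square x^\epsilon.c\rangle^\square\vartriangleright c[V/x]$; $\langle\mu[x^\epsilon].c\|[V]\rangle^-\vartriangleright c[V/x]$; $\langle\mu(\alpha^{\epsilon_1},\beta^{\epsilon_2}).c\|(S,S')\rangle^-\vartriangleright c[S/\alpha,S'/\beta]$; $\langle\mathrm{rec}(\alpha_1^{\epsilon_1}.c_1;\alpha_2^{\epsilon_2}.c_2)\|\pi_iS\rangle^-\vartriangleright c_i[S/\alpha_i]$. Its reflexive transitive closure is $\vartriangleright^*$. \textbf{Typing.} Contexts $(\Gamma \mathbin{/} \Theta\vdash\Delta)$ consist of finite lists of typed variables $\Gamma$ (ordinary) and $\Theta$ (modal), with no variable declared twice in $\Gamma,\Theta$, and of a list of distinct typed covariables $\Delta$; $\diamond$ is the empty list; $\Gamma_\square$ means that all types in $\Gamma$ are modal. The judgments are $\Gamma \mathbin{/} \Theta\vdash V:A;\Delta$ (values), $\Gamma \mathbin{/} \Theta\vdash t:A\mid\Delta$ (expressions), $\Gamma \mathbin{/} \Theta;S:A\vdash\Delta$ (co-values), $\Gamma \mathbin{/} \Theta\mid e:A\vdash\Delta$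 (environments), $c:(\Gamma \mathbin{/} \Theta\vdash\Delta)$ (commands). In the rules below, every term is typed in $K=(\Gamma \mathbin{/} \Theta\vdash\Delta)$ unless stated otherwise, $K,x:A$ is $K$ with $x:A$ added to $\Gamma$, $K,\alpha:A$ is $K$ with $\alpha:A$ added to $\Delta$, and binders carry the polarities of the types of the (co)variables they bind. \begin{itemize} \item Axioms: $x:A \mathbin{/} \diamond\vdash x:A;\diamond$; $\ \diamond \mathbin{/} x:A\vdash x:A;\diamond$; $\ \diamond \mathbin{/} \diamond;\alpha:A\vdash\alpha:A$; $\ \diamond \mathbin{/} \diamond\vdash():\mathbb 1;\diamond$. \item Rules with two premises in contexts $K$ and $K'$ that are disjoint, and conclusion in their union: from $V:A$ and $W:B$, $(V,W):A\otimes B$; from $S:A$ and $S':B$, $(S,S'):A \mathbin{\wp} B$; from $t:A_\boxplus$ and $S:A_\boxplus$, $\langle t\|S\rangle^{\boxplus}$, where the annotation is $\varpi(A)$; from $V:A_-$ and $e:A_-$, $\langle V\|e\rangle^-$. \item Values: $\iota_iV:A_1\oplus A_2$ if $V:A_i$; $\mu\alpha^-.c:A_-$ if $c:(K,\alpha:A)$;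 $\mu(\alpha,\beta).c:A \mathbin{\wp} B$ if $c:(K,\alpha:A,\beta:B)$; $\mu[x].c:\neg A$ if $c:(K,x:A)$; $\mathrm{rec}(\alpha.c_1;\beta.c_2):A\&B$ if $c_1:(K,\alpha:A)$ and $c_2:(K,\beta:B)$; $\Gamma_\square \mathbin{/} \Theta\vdash\square V:\Box A;\diamond$ if $\Gamma_\square \mathbin{/} \Theta\vdash V:A;\diamond$. \item Co-values: $\tilde\mu x^\boxplus.c:A_\boxplus$ if $c:(K,x:A)$; $\tilde\mu().c:\mathbb 1$ if $c:K$; $\tilde\mu(x,y).c:A\otimes B$ if $c:(K,x:A,y:B)$; $\mathrm{case}(x.c_1;y.c_2):A\oplus B$ if $c_1:(K,x:A)$ and $c_2:(K,y:B)$; $[V]:\neg A$ if $V:A$; $\pi_iS:A_1\&A_2$ if $S:A_i$; $\tilde\mu\square x.c:\Box A$ if $c:(\Gamma \mathbin{/} x:A,\Theta\vdash\Delta)$. \item Expressions: a value $V:A_\boxplus$ is an expression of type $A$; $\mu\alpha^\boxplus.c:A_\boxplus$ if $c:(K,\alpha:A)$. Environments: a co-value $S:A_-$ is an environment of type $A$;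 $\tilde\mu x^-.c:A_-$ if $c:(K,x:A)$. \item Renaming (for each of the five judgments): if a term is typed in $(\Gamma \mathbin{/} \Theta\vdash\Delta)$ and $\theta$ maps variables to variables and covariables to covariables, sending declarations of $\Gamma,\Theta,\Delta$ to declarations with the same type in $\Gamma',\Theta',\Delta'$ respectively, then its image under $\theta$ is typed in $(\Gamma' \mathbin{/} \Theta'\vdash\Delta')$, with the same type. \end{itemize} \textbf{Statement.} Let $R$ be a modal type, $\mathit{tp}$ a covariable and $c$ a command with $c:(\diamond \mathbin{/} \diamond\vdash \mathit{tp}:R)$. Then there is a closed value $V$ of type $R$, i.e. with $\diamond \mathbin{/} \diamond\vdash V:R;\diamond$, such that $c\vartriangleright^*\langle V\|\mathit{tp}\rangle^\square$. Moreover this $V$ is unique: if $V'$ is any value with $c\vartriangleright^*\langle V'\|\mathit{tp}\rangle^\square$, then $V'=V$. -/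

import Mathlib

namespace LBox

/-- Polarities `ε`: positive (non-modal) `+`, negative `-`, modal `□`. -/
inductive Pol where
  | pos | neg | box
  deriving DecidableEq

/-- Positive polarities `⊞`: `+` and `□`. -/
inductive PosPol where
  | pos | box
  deriving DecidableEq

def PosPol.toPol : PosPol → Pol
  | .pos => .pos
  | .box => .box

/-- `ε ⊙ ε'` is `□` when both are `□`, and `+` otherwise. -/
def Pol.mul : Pol → Pol → Pol
  | .box, .box => .box
  | _, _ => .pos

/-- Types: `1`, `A ⊗ B`, `A ⊕ B`, `□ A`, `¬ A`, `A & B`, `A ⅋ B`. -/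
inductive Ty where
  | one
  | tensor (A B : Ty)
  | plus (A B : Ty)
  | box (A : Ty)
  | not (A : Ty)
  | amp (A B : Ty)
  | par (A B : Ty)
  deriving DecidableEq

/-- The polarity `ϖ(A)` of a type. -/
def Ty.pol : Ty → Pol
  | .one => .box
  | .tensor A B => A.pol.mul B.pol
  | .plus A B => A.pol.mul B.pol
  | .box _ => .box
  | .not _ => .neg
  | .amp _ _ => .neg
  | .par _ _ => .neg

/-! Terms up to renaming of bound variables, in de Bruijn style. Variables and covariables are two
separate families of indices. A binder of a variable shifts only the variable indices, a binder of
a covariable only the covariable indices; the bound (co)variable is index `0`. A binder of two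
(co)variables, such as `μ̃(x, y).c`, binds `x` as index `1` and `y` as index `0`.
Free (co)variables are named by their indices. -/

mutual
/-- Values `V, W`. -/
inductive Val : Type where
  /-- `x` -/
  | var (x : ℕ)
  /-- `(V, W)` -/
  | pair (V W : Val)
  /-- `□ V` -/
  | box (V : Val)
  /-- `()` -/
  | unit
  /-- `ι₁ V` -/
  | inl (V : Val)
  /-- `ι₂ V` -/
  | inr (V : Val)
  /-- `μ[x^ε].c` -/
  | muNot (ε : Pol) (c : Cmd)
  /-- The lazy record `μ⟨π₁ α^ε₁ . c₁ ; π₂ β^ε₂ . c₂⟩` -/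
  | muRec (ε₁ : Pol) (c₁ : Cmd) (ε₂ : Pol) (c₂ : Cmd)
  /-- `μ(α^ε₁, β^ε₂).c` -/
  | muPar (ε₁ ε₂ : Pol) (c : Cmd)
  /-- `μα^-.c` -/
  | muNeg (c : Cmd)
/-- Co-values `S, S'`. -/
inductive CoVal : Type where
  /-- `α` -/
  | covar (α : ℕ)
  /-- `π₁ S` -/
  | fst (S : CoVal)
  /-- `π₂ S` -/
  | snd (S : CoVal)
  /-- `μ̃□x^ε.c` -/
  | mutBox (ε : Pol) (c : Cmd)
  /-- `[V]` -/
  | not (V : Val)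
  /-- `(S, S')` -/
  | pair (S S' : CoVal)
  /-- `μ̃().c` -/
  | mutUnit (c : Cmd)
  /-- `μ̃x^⊞.c` -/
  | mutPos (p : PosPol) (c : Cmd)
  /-- `μ̃(x^ε₁, y^ε₂).c` -/
  | mutPair (ε₁ ε₂ : Pol) (c : Cmd)
  /-- The case analysis `μ̃[x^ε₁ . c₁ | y^ε₂ . c₂]` -/
  | mutCase (ε₁ : Pol) (c₁ : Cmd) (ε₂ : Pol) (c₂ : Cmd)
/-- Expressions `t`. -/
inductive Tm : Type where
  | val (V : Val)
  /-- `μα^⊞.c` -/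
  | muPos (p : PosPol) (c : Cmd)
/-- Environments `e`. -/
inductive Env : Type where
  | coval (S : CoVal)
  /-- `μ̃x^-.c` -/
  | mutNeg (c : Cmd)
/-- Commands `c`. -/
inductive Cmd : Type where
  /-- `⟨t ‖ S⟩^⊞` -/
  | cutPos (p : PosPol) (t : Tm) (S : CoVal)
  /-- `⟨V ‖ e⟩^-` -/
  | cutNeg (V : Val) (e : Env)
end

/-- A renaming lifted under a binder of the same kind. -/
def upRen (ρ : ℕ → ℕ) : ℕ → ℕ
  | 0 => 0
  | n + 1 => ρ n + 1

/-! Renaming of the free variables by `ρ` and of the free covariables by `κ`. -/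

mutual
def Val.ren (ρ κ : ℕ → ℕ) : Val → Val
  | .var x => .var (ρ x)
  | .pair V W => .pair (V.ren ρ κ) (W.ren ρ κ)
  | .box V => .box (V.ren ρ κ)
  | .unit => .unit
  | .inl V => .inl (V.ren ρ κ)
  | .inr V => .inr (V.ren ρ κ)
  | .muNot ε c => .muNot ε (c.ren (upRen ρ) κ)
  | .muRec ε₁ c₁ ε₂ c₂ => .muRec ε₁ (c₁.ren ρ (upRen κ)) ε₂ (c₂.ren ρ (upRen κ))
  | .muPar ε₁ ε₂ c => .muPar ε₁ ε₂ (c.ren ρ (upRen (upRen κ)))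
  | .muNeg c => .muNeg (c.ren ρ (upRen κ))
def CoVal.ren (ρ κ : ℕ → ℕ) : CoVal → CoVal
  | .covar α => .covar (κ α)
  | .fst S => .fst (S.ren ρ κ)
  | .snd S => .snd (S.ren ρ κ)
  | .mutBox ε c => .mutBox ε (c.ren (upRen ρ) κ)
  | .not V => .not (V.ren ρ κ)
  | .pair S S' => .pair (S.ren ρ κ) (S'.ren ρ κ)
  | .mutUnit c => .mutUnit (c.ren ρ κ)
  | .mutPos p c => .mutPos p (c.ren (upRen ρ) κ)
  | .mutPair ε₁ ε₂ c => .mutPair ε₁ ε₂ (c.ren (upRen (upRen ρ)) κ)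
  | .mutCase ε₁ c₁ ε₂ c₂ => .mutCase ε₁ (c₁.ren (upRen ρ) κ) ε₂ (c₂.ren (upRen ρ) κ)
def Tm.ren (ρ κ : ℕ → ℕ) : Tm → Tm
  | .val V => .val (V.ren ρ κ)
  | .muPos p c => .muPos p (c.ren ρ (upRen κ))
def Env.ren (ρ κ : ℕ → ℕ) : Env → Env
  | .coval S => .coval (S.ren ρ κ)
  | .mutNeg c => .mutNeg (c.ren (upRen ρ) κ)
def Cmd.ren (ρ κ : ℕ → ℕ) : Cmd → Cmd
  | .cutPos p t S => .cutPos p (t.ren ρ κ) (S.ren ρ κ)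
  | .cutNeg V e => .cutNeg (V.ren ρ κ) (e.ren ρ κ)
end

/-- A simultaneous substitution of values for variables and of co-values for covariables. -/
structure Sub where
  var : ℕ → Val
  covar : ℕ → CoVal

/-- The identity substitution. -/
def Sub.id : Sub := ⟨.var, .covar⟩

/-- Extend a substitution at variable index `0`. -/
def Sub.consVar (V : Val) (σ : Sub) : Sub where
  var
    | 0 => V
    | n + 1 => σ.var n
  covar := σ.covar

/-- Extend a substitution at covariable index `0`. -/
def Sub.consCovar (S : CoVal) (σ : Sub) : Sub where
  var := σ.var
  covar
    | 0 => S
    | n + 1 => σ.covar n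

/-- Lift a substitution under a binder of a variable. -/
def Sub.upVar (σ : Sub) : Sub :=
  Sub.consVar (.var 0)
    ⟨fun n => (σ.var n).ren Nat.succ _root_.id, fun n => (σ.covar n).ren Nat.succ _root_.id⟩

/-- Lift a substitution under a binder of a covariable. -/
def Sub.upCovar (σ : Sub) : Sub :=
  Sub.consCovar (.covar 0)
    ⟨fun n => (σ.var n).ren _root_.id Nat.succ, fun n => (σ.covar n).ren _root_.id Nat.succ⟩

/-! Capture-avoiding simultaneous substitution. -/

mutual
def Val.subst (σ : Sub) : Val → Val
  | .var x => σ.var x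
  | .pair V W => .pair (V.subst σ) (W.subst σ)
  | .box V => .box (V.subst σ)
  | .unit => .unit
  | .inl V => .inl (V.subst σ)
  | .inr V => .inr (V.subst σ)
  | .muNot ε c => .muNot ε (c.subst σ.upVar)
  | .muRec ε₁ c₁ ε₂ c₂ => .muRec ε₁ (c₁.subst σ.upCovar) ε₂ (c₂.subst σ.upCovar)
  | .muPar ε₁ ε₂ c => .muPar ε₁ ε₂ (c.subst σ.upCovar.upCovar)
  | .muNeg c => .muNeg (c.subst σ.upCovar)
def CoVal.subst (σ : Sub) : CoVal → CoVal
  | .covar α => σ.covar α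
  | .fst S => .fst (S.subst σ)
  | .snd S => .snd (S.subst σ)
  | .mutBox ε c => .mutBox ε (c.subst σ.upVar)
  | .not V => .not (V.subst σ)
  | .pair S S' => .pair (S.subst σ) (S'.subst σ)
  | .mutUnit c => .mutUnit (c.subst σ)
  | .mutPos p c => .mutPos p (c.subst σ.upVar)
  | .mutPair ε₁ ε₂ c => .mutPair ε₁ ε₂ (c.subst σ.upVar.upVar)
  | .mutCase ε₁ c₁ ε₂ c₂ => .mutCase ε₁ (c₁.subst σ.upVar) ε₂ (c₂.subst σ.upVar)
def Tm.subst (σ : Sub) : Tm → Tm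
  | .val V => .val (V.subst σ)
  | .muPos p c => .muPos p (c.subst σ.upCovar)
def Env.subst (σ : Sub) : Env → Env
  | .coval S => .coval (S.subst σ)
  | .mutNeg c => .mutNeg (c.subst σ.upVar)
def Cmd.subst (σ : Sub) : Cmd → Cmd
  | .cutPos p t S => .cutPos p (t.subst σ) (S.subst σ)
  | .cutNeg V e => .cutNeg (V.subst σ) (e.subst σ)
end

/-- `c[V/x]` where `x` is the variable bound last. -/
def Cmd.substVar (c : Cmd) (V : Val) : Cmd :=
  c.subst (Sub.id.consVar V)

/-- `c[S/α]` where `α` is the covariable bound last. -/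
def Cmd.substCovar (c : Cmd) (S : CoVal) : Cmd :=
  c.subst (Sub.id.consCovar S)

/-- `c[V/x, W/y]` where `x` (index `1`) and `y` (index `0`) are bound together. -/
def Cmd.substVar₂ (c : Cmd) (V W : Val) : Cmd :=
  c.subst ((Sub.id.consVar V).consVar W)

/-- `c[S/α, S'/β]` where `α` (index `1`) and `β` (index `0`) are bound together. -/
def Cmd.substCovar₂ (c : Cmd) (S S' : CoVal) : Cmd :=
  c.subst ((Sub.id.consCovar S).consCovar S')

/-- The toplevel operational semantics `c ▷ c'`. -/
inductive Step : Cmd → Cmd → Prop where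
  /-- `⟨μα^⊞.c ‖ S⟩^⊞ ▷ c[S/α]` -/
  | muPos (p : PosPol) (c : Cmd) (S : CoVal) :
      Step (.cutPos p (.muPos p c) S) (c.substCovar S)
  /-- `⟨μα^-.c ‖ S⟩^- ▷ c[S/α]` -/
  | muNeg (c : Cmd) (S : CoVal) :
      Step (.cutNeg (.muNeg c) (.coval S)) (c.substCovar S)
  /-- `⟨V ‖ μ̃x^⊞.c⟩^⊞ ▷ c[V/x]` -/
  | mutPos (p : PosPol) (V : Val) (c : Cmd) :
      Step (.cutPos p (.val V) (.mutPos p c)) (c.substVar V)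
  /-- `⟨V ‖ μ̃x^-.c⟩^- ▷ c[V/x]` -/
  | mutNeg (V : Val) (c : Cmd) :
      Step (.cutNeg V (.mutNeg c)) (c.substVar V)
  /-- `⟨() ‖ μ̃().c⟩^□ ▷ c` -/
  | unit (c : Cmd) :
      Step (.cutPos .box (.val .unit) (.mutUnit c)) c
  /-- `⟨(V, W) ‖ μ̃(x, y).c⟩ ▷ c[V/x, W/y]` -/
  | pair (p : PosPol) (V W : Val) (ε₁ ε₂ : Pol) (c : Cmd) :
      Step (.cutPos p (.val (.pair V W)) (.mutPair ε₁ ε₂ c)) (c.substVar₂ V W)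
  /-- `⟨ι₁ V ‖ μ̃[x₁.c₁ | x₂.c₂]⟩ ▷ c₁[V/x₁]` -/
  | inl (p : PosPol) (V : Val) (ε₁ ε₂ : Pol) (c₁ c₂ : Cmd) :
      Step (.cutPos p (.val (.inl V)) (.mutCase ε₁ c₁ ε₂ c₂)) (c₁.substVar V)
  /-- `⟨ι₂ V ‖ μ̃[x₁.c₁ | x₂.c₂]⟩ ▷ c₂[V/x₂]` -/
  | inr (p : PosPol) (V : Val) (ε₁ ε₂ : Pol) (c₁ c₂ : Cmd) :
      Step (.cutPos p (.val (.inr V)) (.mutCase ε₁ c₁ ε₂ c₂)) (c₂.substVar V)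
  /-- `⟨□ V ‖ μ̃□x.c⟩^□ ▷ c[V/x]` -/
  | box (V : Val) (ε : Pol) (c : Cmd) :
      Step (.cutPos .box (.val (.box V)) (.mutBox ε c)) (c.substVar V)
  /-- `⟨μ[x].c ‖ [V]⟩^- ▷ c[V/x]` -/
  | not (ε : Pol) (c : Cmd) (V : Val) :
      Step (.cutNeg (.muNot ε c) (.coval (.not V))) (c.substVar V)
  /-- `⟨μ(α, β).c ‖ (S, S')⟩^- ▷ c[S/α, S'/β]` -/
  | par (ε₁ ε₂ : Pol) (c : Cmd) (S S' : CoVal) :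
      Step (.cutNeg (.muPar ε₁ ε₂ c) (.coval (.pair S S'))) (c.substCovar₂ S S')
  /-- `⟨μ⟨π₁ α₁.c₁ ; π₂ α₂.c₂⟩ ‖ π₁ S⟩^- ▷ c₁[S/α₁]` -/
  | fst (ε₁ ε₂ : Pol) (c₁ c₂ : Cmd) (S : CoVal) :
      Step (.cutNeg (.muRec ε₁ c₁ ε₂ c₂) (.coval (.fst S))) (c₁.substCovar S)
  /-- `⟨μ⟨π₁ α₁.c₁ ; π₂ α₂.c₂⟩ ‖ π₂ S⟩^- ▷ c₂[S/α₂]` -/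
  | snd (ε₁ ε₂ : Pol) (c₁ c₂ : Cmd) (S : CoVal) :
      Step (.cutNeg (.muRec ε₁ c₁ ε₂ c₂) (.coval (.snd S))) (c₂.substCovar S)

/-- `c ▷* c'`. -/
def Steps : Cmd → Cmd → Prop := Relation.ReflTransGen Step

/-- A context `(Γ ¦ Θ ⊢ Δ)`: lists of typed variables (`Γ` ordinary, `Θ` modal) and of typed
covariables (`Δ`). -/
structure Ctx where
  Γ : List (ℕ × Ty)
  Θ : List (ℕ × Ty)
  Δ : List (ℕ × Ty)

namespace Ctx

/-- No variable is declared twice in `Γ, Θ`, and no covariable is declared twice in `Δ`. -/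
def WF (K : Ctx) : Prop :=
  ((K.Γ ++ K.Θ).map Prod.fst).Nodup ∧ (K.Δ.map Prod.fst).Nodup

/-- `(⋄ ¦ ⋄ ⊢ ⋄)` -/
def empty : Ctx := ⟨[], [], []⟩

/-- `(Γ, Γ' ¦ Θ, Θ' ⊢ Δ, Δ')`; the rules that use it ask for disjointness through `WF`. -/
def append (K K' : Ctx) : Ctx := ⟨K.Γ ++ K'.Γ, K.Θ ++ K'.Θ, K.Δ ++ K'.Δ⟩

/-- Make index `0` fresh. -/
def shift (L : List (ℕ × Ty)) : List (ℕ × Ty) := L.map fun p => (p.1 + 1, p.2)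

/-- `(Γ, x : A ¦ Θ ⊢ Δ)` with `x` fresh. -/
def bindVar (A : Ty) (K : Ctx) : Ctx := ⟨(0, A) :: shift K.Γ, shift K.Θ, K.Δ⟩

/-- `(Γ ¦ x : A, Θ ⊢ Δ)` with `x` fresh. -/
def bindModal (A : Ty) (K : Ctx) : Ctx := ⟨shift K.Γ, (0, A) :: shift K.Θ, K.Δ⟩

/-- `(Γ ¦ Θ ⊢ α : A, Δ)` with `α` fresh. -/
def bindCovar (A : Ty) (K : Ctx) : Ctx := ⟨K.Γ, K.Θ, (0, A) :: shift K.Δ⟩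

/-- The context has the form `(Γ_□ ¦ Θ ⊢ ⋄)`. -/
def IsModal (K : Ctx) : Prop := (∀ p ∈ K.Γ, p.2.pol = .box) ∧ K.Δ = []

/-- `(ρ, κ)` is a renaming from `K` to `K'`: it respects the three zones and the types. -/
structure IsRenaming (ρ κ : ℕ → ℕ) (K K' : Ctx) : Prop where
  Γ : ∀ x A, (x, A) ∈ K.Γ → (ρ x, A) ∈ K'.Γ
  Θ : ∀ x A, (x, A) ∈ K.Θ → (ρ x, A) ∈ K'.Θ
  Δ : ∀ α A, (α, A) ∈ K.Δ → (κ α, A) ∈ K'.Δ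

end Ctx

/-! The typing rules. -/

mutual
/-- `Γ ¦ Θ ⊢ V : A ; Δ` -/
inductive ValTy : Ctx → Val → Ty → Prop where
  | ax (x : ℕ) (A : Ty) : ValTy ⟨[(x, A)], [], []⟩ (.var x) A
  | boxAx (x : ℕ) (A : Ty) : ValTy ⟨[], [(x, A)], []⟩ (.var x) A
  | muNeg {K : Ctx} {c : Cmd} {A : Ty} (hA : A.pol = .neg)
      (hc : CmdTy (K.bindCovar A) c) : ValTy K (.muNeg c) A
  | unit : ValTy Ctx.empty .unit .one
  | pair {K K' : Ctx} {V W : Val} {A B : Ty} (hK : (K.append K').WF)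
      (hV : ValTy K V A) (hW : ValTy K' W B) :
      ValTy (K.append K') (.pair V W) (.tensor A B)
  | inl {K : Ctx} {V : Val} {A B : Ty} (hV : ValTy K V A) : ValTy K (.inl V) (.plus A B)
  | inr {K : Ctx} {V : Val} {A B : Ty} (hV : ValTy K V B) : ValTy K (.inr V) (.plus A B)
  | muPar {K : Ctx} {c : Cmd} {A B : Ty} {ε₁ ε₂ : Pol} (hA : A.pol = ε₁) (hB : B.pol = ε₂)
      (hc : CmdTy ((K.bindCovar A).bindCovar B) c) : ValTy K (.muPar ε₁ ε₂ c) (.par A B)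
  | muNot {K : Ctx} {c : Cmd} {A : Ty} {ε : Pol} (hA : A.pol = ε)
      (hc : CmdTy (K.bindVar A) c) : ValTy K (.muNot ε c) (.not A)
  | muRec {K : Ctx} {c₁ c₂ : Cmd} {A B : Ty} {ε₁ ε₂ : Pol} (hA : A.pol = ε₁) (hB : B.pol = ε₂)
      (hc₁ : CmdTy (K.bindCovar A) c₁) (hc₂ : CmdTy (K.bindCovar B) c₂) :
      ValTy K (.muRec ε₁ c₁ ε₂ c₂) (.amp A B)
  | box {K : Ctx} {V : Val} {A : Ty} (hK : K.IsModal) (hV : ValTy K V A) :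
      ValTy K (.box V) (.box A)
  | ren {K K' : Ctx} {V : Val} {A : Ty} (ρ κ : ℕ → ℕ) (hK' : K'.WF)
      (hr : Ctx.IsRenaming ρ κ K K') (hV : ValTy K V A) : ValTy K' (V.ren ρ κ) A
/-- `Γ ¦ Θ ; S : A ⊢ Δ` -/
inductive CoValTy : Ctx → CoVal → Ty → Prop where
  | ax (α : ℕ) (A : Ty) : CoValTy ⟨[], [], [(α, A)]⟩ (.covar α) A
  | mutPos {K : Ctx} {c : Cmd} {A : Ty} {p : PosPol} (hA : A.pol = p.toPol)
      (hc : CmdTy (K.bindVar A) c) : CoValTy K (.mutPos p c) A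
  | mutUnit {K : Ctx} {c : Cmd} (hc : CmdTy K c) : CoValTy K (.mutUnit c) .one
  | mutPair {K : Ctx} {c : Cmd} {A B : Ty} {ε₁ ε₂ : Pol} (hA : A.pol = ε₁) (hB : B.pol = ε₂)
      (hc : CmdTy ((K.bindVar A).bindVar B) c) : CoValTy K (.mutPair ε₁ ε₂ c) (.tensor A B)
  | mutCase {K : Ctx} {c₁ c₂ : Cmd} {A B : Ty} {ε₁ ε₂ : Pol} (hA : A.pol = ε₁) (hB : B.pol = ε₂)
      (hc₁ : CmdTy (K.bindVar A) c₁) (hc₂ : CmdTy (K.bindVar B) c₂) :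
      CoValTy K (.mutCase ε₁ c₁ ε₂ c₂) (.plus A B)
  | pair {K K' : Ctx} {S S' : CoVal} {A B : Ty} (hK : (K.append K').WF)
      (hS : CoValTy K S A) (hS' : CoValTy K' S' B) :
      CoValTy (K.append K') (.pair S S') (.par A B)
  | not {K : Ctx} {V : Val} {A : Ty} (hV : ValTy K V A) : CoValTy K (.not V) (.not A)
  | fst {K : Ctx} {S : CoVal} {A B : Ty} (hS : CoValTy K S A) : CoValTy K (.fst S) (.amp A B)
  | snd {K : Ctx} {S : CoVal} {A B : Ty} (hS : CoValTy K S B) : CoValTy K (.snd S) (.amp A B)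
  | mutBox {K : Ctx} {c : Cmd} {A : Ty} {ε : Pol} (hA : A.pol = ε)
      (hc : CmdTy (K.bindModal A) c) : CoValTy K (.mutBox ε c) (.box A)
  | ren {K K' : Ctx} {S : CoVal} {A : Ty} (ρ κ : ℕ → ℕ) (hK' : K'.WF)
      (hr : Ctx.IsRenaming ρ κ K K') (hS : CoValTy K S A) : CoValTy K' (S.ren ρ κ) A
/-- `Γ ¦ Θ ⊢ t : A | Δ` -/
inductive TmTy : Ctx → Tm → Ty → Prop where
  | val {K : Ctx} {V : Val} {A : Ty} {p : PosPol} (hA : A.pol = p.toPol)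
      (hV : ValTy K V A) : TmTy K (.val V) A
  | muPos {K : Ctx} {c : Cmd} {A : Ty} {p : PosPol} (hA : A.pol = p.toPol)
      (hc : CmdTy (K.bindCovar A) c) : TmTy K (.muPos p c) A
  | ren {K K' : Ctx} {t : Tm} {A : Ty} (ρ κ : ℕ → ℕ) (hK' : K'.WF)
      (hr : Ctx.IsRenaming ρ κ K K') (ht : TmTy K t A) : TmTy K' (t.ren ρ κ) A
/-- `Γ ¦ Θ | e : A ⊢ Δ` -/
inductive EnvTy : Ctx → Env → Ty → Prop where
  | coval {K : Ctx} {S : CoVal} {A : Ty} (hA : A.pol = .neg)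
      (hS : CoValTy K S A) : EnvTy K (.coval S) A
  | mutNeg {K : Ctx} {c : Cmd} {A : Ty} (hA : A.pol = .neg)
      (hc : CmdTy (K.bindVar A) c) : EnvTy K (.mutNeg c) A
  | ren {K K' : Ctx} {e : Env} {A : Ty} (ρ κ : ℕ → ℕ) (hK' : K'.WF)
      (hr : Ctx.IsRenaming ρ κ K K') (he : EnvTy K e A) : EnvTy K' (e.ren ρ κ) A
/-- `c : (Γ ¦ Θ ⊢ Δ)` -/
inductive CmdTy : Ctx → Cmd → Prop where
  | cutPos {K K' : Ctx} {t : Tm} {S : CoVal} {A : Ty} {p : PosPol} (hK : (K.append K').WF)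
      (hA : A.pol = p.toPol) (ht : TmTy K t A) (hS : CoValTy K' S A) :
      CmdTy (K.append K') (.cutPos p t S)
  | cutNeg {K K' : Ctx} {V : Val} {e : Env} {A : Ty} (hK : (K.append K').WF)
      (hA : A.pol = .neg) (hV : ValTy K V A) (he : EnvTy K' e A) :
      CmdTy (K.append K') (.cutNeg V e)
  | ren {K K' : Ctx} {c : Cmd} (ρ κ : ℕ → ℕ) (hK' : K'.WF)
      (hr : Ctx.IsRenaming ρ κ K K') (hc : CmdTy K c) : CmdTy K' (c.ren ρ κ)
end

end LBox

namespace LBox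

-- The proof is by realizability, in the style of Krivine. A pole is a set of commands closed under
-- anti-reduction. Relative to a pole, a positive type is interpreted by a set of values built from
-- realizers of its components, and its co-values are all those orthogonal to that set; a negative
-- type is interpreted dually, from co-values (`Ty.sem`). Adequacy says that a typed term, after
-- substitution of realizers for its free (co)variables, is a realizer; for a command, this means
-- that it lies in the pole.
--
-- The modality enters through one clause: a realizer of `□A` is some `□V` where `V` realizes `A`
-- and is also a closed value typed by `A`. Since `ε ⊙ ε'` is `□` only when both factors are, every
-- realizer of a modal type is then a closed typed value (`ValTy.of_mem_sem`). The promotion rule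
-- allows only modal ordinary variables, modal-zone variables and no covariables, so a realizing
-- substitution fills its context with closed typed values, and the substitution lemma
-- `subst_closing` types the promoted value in the empty context.
--
-- The pole chosen is the set of commands that reduce to `⟨V ‖ tp⟩` with `V` closed of type `R`
-- (`evalPole`). Because `R` is modal, its realizers are closed of type `R`, so `tp` is orthogonal
-- to them in zero steps. Adequacy with the identity substitution gives existence. The typing of the
-- result is carried by the pole, so subject reduction is never needed. Uniqueness holds because
-- reduction is deterministic and `⟨V ‖ tp⟩` is normal.

attribute [ext] Sub

-- The calculus of renamings and substitutions

/-- Precomposition of a substitution with a renaming. -/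
def Sub.preRen (σ : Sub) (ρ κ : ℕ → ℕ) : Sub := ⟨fun n => σ.var (ρ n), fun n => σ.covar (κ n)⟩

/-- Postcomposition of a substitution with a renaming. -/
def Sub.postRen (σ : Sub) (ρ κ : ℕ → ℕ) : Sub :=
  ⟨fun n => (σ.var n).ren ρ κ, fun n => (σ.covar n).ren ρ κ⟩

/-- Composition of substitutions: first `σ`, then `τ`. -/
def Sub.comp (σ τ : Sub) : Sub := ⟨fun n => (σ.var n).subst τ, fun n => (σ.covar n).subst τ⟩

theorem Sub.upVar_preRen (σ : Sub) (ρ κ : ℕ → ℕ) :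
    (σ.preRen ρ κ).upVar = σ.upVar.preRen (upRen ρ) κ := by
  ext n
  · cases n <;> rfl
  · rfl

theorem Sub.upCovar_preRen (σ : Sub) (ρ κ : ℕ → ℕ) :
    (σ.preRen ρ κ).upCovar = σ.upCovar.preRen ρ (upRen κ) := by
  ext n
  · rfl
  · cases n <;> rfl

mutual
theorem Val.ren_subst (σ : Sub) (ρ κ : ℕ → ℕ) (V : Val) :
    (V.ren ρ κ).subst σ = V.subst (σ.preRen ρ κ) := by
  cases V <;> simp only [Val.ren, Val.subst, Sub.upVar_preRen, Sub.upCovar_preRen, Val.ren_subst,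
    Cmd.ren_subst]
  rfl
termination_by structural V
theorem CoVal.ren_subst (σ : Sub) (ρ κ : ℕ → ℕ) (S : CoVal) :
    (S.ren ρ κ).subst σ = S.subst (σ.preRen ρ κ) := by
  cases S <;> simp only [CoVal.ren, CoVal.subst, Sub.upVar_preRen,
    Val.ren_subst, CoVal.ren_subst, Cmd.ren_subst]
  rfl
termination_by structural S
theorem Tm.ren_subst (σ : Sub) (ρ κ : ℕ → ℕ) (t : Tm) :
    (t.ren ρ κ).subst σ = t.subst (σ.preRen ρ κ) := by
  cases t <;> simp only [Tm.ren, Tm.subst, Sub.upCovar_preRen, Val.ren_subst, Cmd.ren_subst]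
termination_by structural t
theorem Env.ren_subst (σ : Sub) (ρ κ : ℕ → ℕ) (e : Env) :
    (e.ren ρ κ).subst σ = e.subst (σ.preRen ρ κ) := by
  cases e <;> simp only [Env.ren, Env.subst, Sub.upVar_preRen, CoVal.ren_subst, Cmd.ren_subst]
termination_by structural e
theorem Cmd.ren_subst (σ : Sub) (ρ κ : ℕ → ℕ) (c : Cmd) :
    (c.ren ρ κ).subst σ = c.subst (σ.preRen ρ κ) := by
  cases c <;> simp only [Cmd.ren, Cmd.subst, Val.ren_subst, CoVal.ren_subst, Tm.ren_subst,
    Env.ren_subst]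
termination_by structural c
end

@[simp] theorem Sub.upVar_id : Sub.id.upVar = Sub.id := by
  ext n
  · cases n <;> rfl
  · rfl

@[simp] theorem Sub.upCovar_id : Sub.id.upCovar = Sub.id := by
  ext n
  · rfl
  · cases n <;> rfl

mutual
theorem Val.subst_id (V : Val) :
    V.subst Sub.id = V := by
  cases V <;> simp only [Val.subst, Sub.upVar_id, Sub.upCovar_id,
    Val.subst_id, Cmd.subst_id]
  rfl
termination_by structural V
theorem CoVal.subst_id (S : CoVal) :
    S.subst Sub.id = S := by
  cases S <;> simp only [CoVal.subst, Sub.upVar_id,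
    Val.subst_id, CoVal.subst_id, Cmd.subst_id]
  rfl
termination_by structural S
theorem Tm.subst_id (t : Tm) :
    t.subst Sub.id = t := by
  cases t <;> simp only [Tm.subst, Sub.upCovar_id,
    Val.subst_id, Cmd.subst_id]
termination_by structural t
theorem Env.subst_id (e : Env) :
    e.subst Sub.id = e := by
  cases e <;> simp only [Env.subst, Sub.upVar_id,
    CoVal.subst_id, Cmd.subst_id]
termination_by structural e
theorem Cmd.subst_id (c : Cmd) :
    c.subst Sub.id = c := by
  cases c <;> simp only [Cmd.subst,
    Val.subst_id, CoVal.subst_id, Tm.subst_id, Env.subst_id]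
termination_by structural c
end

theorem Val.ren_eq_subst (ρ κ : ℕ → ℕ) (V : Val) : V.ren ρ κ = V.subst (Sub.id.preRen ρ κ) := by
  rw [← Val.ren_subst, Val.subst_id]

theorem CoVal.ren_eq_subst (ρ κ : ℕ → ℕ) (S : CoVal) :
    S.ren ρ κ = S.subst (Sub.id.preRen ρ κ) := by
  rw [← CoVal.ren_subst, CoVal.subst_id]

theorem Tm.ren_eq_subst (ρ κ : ℕ → ℕ) (t : Tm) : t.ren ρ κ = t.subst (Sub.id.preRen ρ κ) := by
  rw [← Tm.ren_subst, Tm.subst_id]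

theorem Env.ren_eq_subst (ρ κ : ℕ → ℕ) (e : Env) : e.ren ρ κ = e.subst (Sub.id.preRen ρ κ) := by
  rw [← Env.ren_subst, Env.subst_id]

/-- A renaming is a substitution by (co)variables, so `Val.ren_subst` already contains the fusion of
two renamings and no new induction is needed. -/
theorem Val.ren_ren (ρ κ ρ' κ' : ℕ → ℕ) (V : Val) :
    (V.ren ρ κ).ren ρ' κ' = V.ren (ρ' ∘ ρ) (κ' ∘ κ) := by
  rw [Val.ren_eq_subst ρ', Val.ren_subst, Val.ren_eq_subst]; rfl

theorem CoVal.ren_ren (ρ κ ρ' κ' : ℕ → ℕ) (S : CoVal) :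
    (S.ren ρ κ).ren ρ' κ' = S.ren (ρ' ∘ ρ) (κ' ∘ κ) := by
  rw [CoVal.ren_eq_subst ρ', CoVal.ren_subst, CoVal.ren_eq_subst]; rfl

theorem Tm.ren_ren (ρ κ ρ' κ' : ℕ → ℕ) (t : Tm) :
    (t.ren ρ κ).ren ρ' κ' = t.ren (ρ' ∘ ρ) (κ' ∘ κ) := by
  rw [Tm.ren_eq_subst ρ', Tm.ren_subst, Tm.ren_eq_subst]; rfl

theorem Env.ren_ren (ρ κ ρ' κ' : ℕ → ℕ) (e : Env) :
    (e.ren ρ κ).ren ρ' κ' = e.ren (ρ' ∘ ρ) (κ' ∘ κ) := by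
  rw [Env.ren_eq_subst ρ', Env.ren_subst, Env.ren_eq_subst]; rfl

theorem Val.ren_id (V : Val) : V.ren id id = V := by
  rw [Val.ren_eq_subst]; exact V.subst_id

theorem CoVal.ren_id (S : CoVal) : S.ren id id = S := by
  rw [CoVal.ren_eq_subst]; exact S.subst_id

theorem Tm.ren_id (t : Tm) : t.ren id id = t := by
  rw [Tm.ren_eq_subst]; exact t.subst_id

theorem Env.ren_id (e : Env) : e.ren id id = e := by
  rw [Env.ren_eq_subst]; exact e.subst_id

theorem Sub.upVar_postRen (ρ κ : ℕ → ℕ) (σ : Sub) :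
    (σ.postRen ρ κ).upVar = σ.upVar.postRen (upRen ρ) κ := by
  ext n
  · cases n with
    | zero => rfl
    | succ n => exact (Val.ren_ren ..).trans (Val.ren_ren Nat.succ _root_.id (upRen ρ) κ (σ.var n)).symm
  · exact (CoVal.ren_ren ..).trans (CoVal.ren_ren Nat.succ _root_.id (upRen ρ) κ (σ.covar n)).symm

theorem Sub.upCovar_postRen (ρ κ : ℕ → ℕ) (σ : Sub) :
    (σ.postRen ρ κ).upCovar = σ.upCovar.postRen ρ (upRen κ) := by
  ext n
  · exact (Val.ren_ren ..).trans (Val.ren_ren _root_.id Nat.succ ρ (upRen κ) (σ.var n)).symm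
  · cases n with
    | zero => rfl
    | succ n => exact (CoVal.ren_ren ..).trans (CoVal.ren_ren _root_.id Nat.succ ρ (upRen κ) (σ.covar n)).symm

mutual
theorem Val.subst_ren (ρ κ : ℕ → ℕ) (σ : Sub) (V : Val) :
    (V.subst σ).ren ρ κ = V.subst (σ.postRen ρ κ) := by
  cases V <;> simp only [Val.ren, Val.subst, Sub.upVar_postRen, Sub.upCovar_postRen,
    Val.subst_ren, Cmd.subst_ren]
  rfl
termination_by structural V
theorem CoVal.subst_ren (ρ κ : ℕ → ℕ) (σ : Sub) (S : CoVal) :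
    (S.subst σ).ren ρ κ = S.subst (σ.postRen ρ κ) := by
  cases S <;> simp only [CoVal.ren, CoVal.subst, Sub.upVar_postRen,
    Val.subst_ren, CoVal.subst_ren, Cmd.subst_ren]
  rfl
termination_by structural S
theorem Tm.subst_ren (ρ κ : ℕ → ℕ) (σ : Sub) (t : Tm) :
    (t.subst σ).ren ρ κ = t.subst (σ.postRen ρ κ) := by
  cases t <;> simp only [Tm.ren, Tm.subst, Sub.upCovar_postRen,
    Val.subst_ren, Cmd.subst_ren]
termination_by structural t
theorem Env.subst_ren (ρ κ : ℕ → ℕ) (σ : Sub) (e : Env) :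
    (e.subst σ).ren ρ κ = e.subst (σ.postRen ρ κ) := by
  cases e <;> simp only [Env.ren, Env.subst, Sub.upVar_postRen,
    CoVal.subst_ren, Cmd.subst_ren]
termination_by structural e
theorem Cmd.subst_ren (ρ κ : ℕ → ℕ) (σ : Sub) (c : Cmd) :
    (c.subst σ).ren ρ κ = c.subst (σ.postRen ρ κ) := by
  cases c <;> simp only [Cmd.ren, Cmd.subst,
    Val.subst_ren, CoVal.subst_ren, Tm.subst_ren, Env.subst_ren]
termination_by structural c
end

theorem Sub.upVar_comp (σ τ : Sub) : (σ.comp τ).upVar = σ.upVar.comp τ.upVar := by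
  ext n
  · cases n with
    | zero => rfl
    | succ n => exact (Val.subst_ren ..).trans (Val.ren_subst τ.upVar Nat.succ _root_.id (σ.var n)).symm
  · exact (CoVal.subst_ren ..).trans (CoVal.ren_subst τ.upVar Nat.succ _root_.id (σ.covar n)).symm

theorem Sub.upCovar_comp (σ τ : Sub) : (σ.comp τ).upCovar = σ.upCovar.comp τ.upCovar := by
  ext n
  · exact (Val.subst_ren ..).trans (Val.ren_subst τ.upCovar _root_.id Nat.succ (σ.var n)).symm
  · cases n with
    | zero => rfl
    | succ n => exact (CoVal.subst_ren ..).trans (CoVal.ren_subst τ.upCovar _root_.id Nat.succ (σ.covar n)).symm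

mutual
theorem Val.subst_subst (σ τ : Sub) (V : Val) :
    (V.subst σ).subst τ = V.subst (σ.comp τ) := by
  cases V <;> simp only [Val.subst, Sub.upVar_comp, Sub.upCovar_comp,
    Val.subst_subst, Cmd.subst_subst]
  rfl
termination_by structural V
theorem CoVal.subst_subst (σ τ : Sub) (S : CoVal) :
    (S.subst σ).subst τ = S.subst (σ.comp τ) := by
  cases S <;> simp only [CoVal.subst, Sub.upVar_comp,
    Val.subst_subst, CoVal.subst_subst, Cmd.subst_subst]
  rfl
termination_by structural S
theorem Tm.subst_subst (σ τ : Sub) (t : Tm) :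
    (t.subst σ).subst τ = t.subst (σ.comp τ) := by
  cases t <;> simp only [Tm.subst, Sub.upCovar_comp,
    Val.subst_subst, Cmd.subst_subst]
termination_by structural t
theorem Env.subst_subst (σ τ : Sub) (e : Env) :
    (e.subst σ).subst τ = e.subst (σ.comp τ) := by
  cases e <;> simp only [Env.subst, Sub.upVar_comp,
    CoVal.subst_subst, Cmd.subst_subst]
termination_by structural e
theorem Cmd.subst_subst (σ τ : Sub) (c : Cmd) :
    (c.subst σ).subst τ = c.subst (σ.comp τ) := by
  cases c <;> simp only [Cmd.subst,
    Val.subst_subst, CoVal.subst_subst, Tm.subst_subst, Env.subst_subst]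
termination_by structural c
end

theorem Sub.upVar_comp_consVar (σ τ : Sub) (V : Val) :
    σ.upVar.comp (τ.consVar V) = (σ.comp τ).consVar V := by
  ext n
  · cases n with
    | zero => rfl
    | succ n => exact Val.ren_subst ..
  · exact CoVal.ren_subst ..

theorem Sub.upCovar_comp_consCovar (σ τ : Sub) (S : CoVal) :
    σ.upCovar.comp (τ.consCovar S) = (σ.comp τ).consCovar S := by
  ext n
  · exact Val.ren_subst ..
  · cases n with
    | zero => rfl
    | succ n => exact CoVal.ren_subst ..

theorem Sub.comp_id (σ : Sub) : σ.comp Sub.id = σ := by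
  ext n
  · exact Val.subst_id _
  · exact CoVal.subst_id _

/-- Firing a redex after a substitution `σ` amounts to extending `σ` by the argument. In the
adequacy proof this turns the reduct of a substituted term into the induction hypothesis for the
body of the binder. -/
theorem Cmd.subst_upVar_substVar (σ : Sub) (c : Cmd) (V : Val) :
    (c.subst σ.upVar).substVar V = c.subst (σ.consVar V) := by
  rw [Cmd.substVar, Cmd.subst_subst, Sub.upVar_comp_consVar, Sub.comp_id]

theorem Cmd.subst_upCovar_substCovar (σ : Sub) (c : Cmd) (S : CoVal) :
    (c.subst σ.upCovar).substCovar S = c.subst (σ.consCovar S) := by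
  rw [Cmd.substCovar, Cmd.subst_subst, Sub.upCovar_comp_consCovar, Sub.comp_id]

theorem Cmd.subst_upVar_substVar₂ (σ : Sub) (c : Cmd) (V W : Val) :
    (c.subst σ.upVar.upVar).substVar₂ V W = c.subst ((σ.consVar V).consVar W) := by
  rw [Cmd.substVar₂, Cmd.subst_subst, Sub.upVar_comp_consVar, Sub.upVar_comp_consVar, Sub.comp_id]

theorem Cmd.subst_upCovar_substCovar₂ (σ : Sub) (c : Cmd) (S S' : CoVal) :
    (c.subst σ.upCovar.upCovar).substCovar₂ S S' = c.subst ((σ.consCovar S).consCovar S') := by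
  rw [Cmd.substCovar₂, Cmd.subst_subst, Sub.upCovar_comp_consCovar, Sub.upCovar_comp_consCovar,
    Sub.comp_id]

-- Well-formed contexts, weakening and renaming

theorem Ctx.empty_WF : Ctx.empty.WF := ⟨List.nodup_nil, List.nodup_nil⟩

theorem Ctx.mem_shift {L : List (ℕ × Ty)} {x : ℕ} {A : Ty} :
    (x, A) ∈ Ctx.shift L ↔ ∃ y, x = y + 1 ∧ (y, A) ∈ L := by
  simp only [Ctx.shift, List.mem_map, Prod.mk.injEq, Prod.exists]
  constructor
  · rintro ⟨y, B, h, rfl, rfl⟩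
    exact ⟨y, rfl, h⟩
  · rintro ⟨y, rfl, h⟩
    exact ⟨y, A, h, rfl, rfl⟩

theorem Ctx.shift_append (L L' : List (ℕ × Ty)) :
    Ctx.shift L ++ Ctx.shift L' = Ctx.shift (L ++ L') := by
  simp [Ctx.shift]

theorem Ctx.nodup_cons_shift {L : List (ℕ × Ty)} (A : Ty) (h : (L.map Prod.fst).Nodup) :
    (((0, A) :: Ctx.shift L).map Prod.fst).Nodup := by
  have e : (Ctx.shift L).map Prod.fst = (L.map Prod.fst).map Nat.succ := by
    simp [Ctx.shift, Function.comp_def]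
  rw [List.map_cons, e, List.nodup_cons]
  exact ⟨by simp, h.map Nat.succ_injective⟩

theorem Ctx.WF.bindVar {K : Ctx} (h : K.WF) (A : Ty) : (K.bindVar A).WF := by
  refine ⟨?_, h.2⟩
  simpa only [Ctx.bindVar, List.cons_append, Ctx.shift_append] using Ctx.nodup_cons_shift A h.1

theorem Ctx.WF.bindModal {K : Ctx} (h : K.WF) (A : Ty) : (K.bindModal A).WF := by
  refine ⟨?_, h.2⟩
  have := Ctx.nodup_cons_shift A h.1
  rw [← Ctx.shift_append, ← List.cons_append] at this
  -- The modal variable is declared between `Γ` and `Θ`; a permutation moves it to the head of the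
  -- list.
  refine ((List.perm_middle (l₁ := Ctx.shift K.Γ)).map Prod.fst).nodup_iff.2 ?_
  simpa using this

theorem Ctx.WF.bindCovar {K : Ctx} (h : K.WF) (A : Ty) : (K.bindCovar A).WF :=
  ⟨h.1, Ctx.nodup_cons_shift A h.2⟩

theorem Ctx.isRenaming_id {K L : Ctx} (hΓ : K.Γ ⊆ L.Γ) (hΘ : K.Θ ⊆ L.Θ) (hΔ : K.Δ ⊆ L.Δ) :
    Ctx.IsRenaming id id K L :=
  ⟨fun _ _ h => hΓ h, fun _ _ h => hΘ h, fun _ _ h => hΔ h⟩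

theorem ValTy.weaken {K L : Ctx} {V : Val} {A : Ty} (hV : ValTy K V A) (hL : L.WF)
    (hr : Ctx.IsRenaming id id K L) : ValTy L V A := by
  simpa only [Val.ren_id] using ValTy.ren id id hL hr hV

theorem CoValTy.weaken {K L : Ctx} {S : CoVal} {A : Ty} (hS : CoValTy K S A) (hL : L.WF)
    (hr : Ctx.IsRenaming id id K L) : CoValTy L S A := by
  simpa only [CoVal.ren_id] using CoValTy.ren id id hL hr hS

theorem Ctx.isRenaming_empty (ρ κ : ℕ → ℕ) (K : Ctx) : Ctx.IsRenaming ρ κ Ctx.empty K :=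
  ⟨fun _ _ h => (by cases h), fun _ _ h => (by cases h), fun _ _ h => (by cases h)⟩

/-- The empty context has no declarations to respect, so the renaming rule applies to any `ρ, κ`.
This avoids showing that renaming fixes closed values. -/
theorem ValTy.ren_of_empty {V : Val} {A : Ty} (hV : ValTy Ctx.empty V A) (ρ κ : ℕ → ℕ) :
    ValTy Ctx.empty (V.ren ρ κ) A :=
  hV.ren ρ κ Ctx.empty_WF (Ctx.isRenaming_empty ..)

-- Contraction: two-premise rules with a shared context

/-- The context obtained by renaming all declarations. -/
def Ctx.map (f : ℕ → ℕ) (K : Ctx) : Ctx :=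
  ⟨K.Γ.map (Prod.map f id), K.Θ.map (Prod.map f id), K.Δ.map (Prod.map f id)⟩

theorem Ctx.isRenaming_map (f : ℕ → ℕ) (K : Ctx) : Ctx.IsRenaming f f K (K.map f) :=
  ⟨fun x A h => List.mem_map.2 ⟨(x, A), h, rfl⟩, fun x A h => List.mem_map.2 ⟨(x, A), h, rfl⟩,
    fun x A h => List.mem_map.2 ⟨(x, A), h, rfl⟩⟩

theorem Ctx.map_fst_map (f : ℕ → ℕ) (L : List (ℕ × Ty)) :
    (L.map (Prod.map f id)).map Prod.fst = (L.map Prod.fst).map f := by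
  simp [Function.comp_def]

theorem Ctx.WF.map {K : Ctx} (h : K.WF) {f : ℕ → ℕ} (hf : Function.Injective f) :
    (K.map f).WF := by
  refine ⟨?_, ?_⟩
  · rw [Ctx.map, ← List.map_append, Ctx.map_fst_map]
    exact h.1.map hf
  · rw [Ctx.map, Ctx.map_fst_map]
    exact h.2.map hf

theorem Ctx.nodup_map_append_map {L : List ℕ} (h : L.Nodup) {f g : ℕ → ℕ}
    (hf : Function.Injective f) (hg : Function.Injective g) (hfg : ∀ m n, f m ≠ g n) :
    (L.map f ++ L.map g).Nodup := by
  refine List.Nodup.append (h.map hf) (h.map hg) ?_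
  intro a ha hb
  obtain ⟨m, -, rfl⟩ := List.mem_map.1 ha
  obtain ⟨n, -, hn⟩ := List.mem_map.1 hb
  exact hfg m n hn.symm

theorem Ctx.WF.map_append_map {K : Ctx} (h : K.WF) {f g : ℕ → ℕ}
    (hf : Function.Injective f) (hg : Function.Injective g) (hfg : ∀ m n, f m ≠ g n) :
    ((K.map f).append (K.map g)).WF := by
  refine ⟨?_, ?_⟩
  · have := Ctx.nodup_map_append_map h.1 hf hg hfg
    refine List.Perm.nodup ?_ this
    simp only [Ctx.append, Ctx.map, List.map_append, Ctx.map_fst_map, List.append_assoc]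
    -- The two lists differ only by exchanging the second copy of `Γ` with the first copy of `Θ`.
    refine List.Perm.append_left _ ?_
    rw [← List.append_assoc, ← List.append_assoc]
    exact List.Perm.append_right _ List.perm_append_comm
  · have := Ctx.nodup_map_append_map h.2 hf hg hfg
    simpa only [Ctx.append, Ctx.map, List.map_append, Ctx.map_fst_map] using this

theorem Ctx.isRenaming_map_append_map (K : Ctx) {f g k : ℕ → ℕ} (hf : ∀ n, k (f n) = n)
    (hg : ∀ n, k (g n) = n) : Ctx.IsRenaming k k ((K.map f).append (K.map g)) K := by
  have key : ∀ (L : List (ℕ × Ty)) (x : ℕ) (A : Ty),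
      (x, A) ∈ L.map (Prod.map f id) ++ L.map (Prod.map g id) → (k x, A) ∈ L := by
    intro L x A h
    rcases List.mem_append.1 h with h | h <;>
    · obtain ⟨⟨y, B⟩, hy, e⟩ := List.mem_map.1 h
      cases e
      simpa [hf, hg] using hy
  exact ⟨key _, key _, key _⟩

/-- Every well-formed context is a contraction of two disjoint copies of itself. -/
theorem Ctx.WF.exists_split {L : Ctx} (hL : L.WF) : ∃ (K K' : Ctx) (f g k : ℕ → ℕ),
    K.WF ∧ K'.WF ∧ (K.append K').WF ∧ Ctx.IsRenaming f f L K ∧ Ctx.IsRenaming g g L K' ∧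
      Ctx.IsRenaming k k (K.append K') L ∧ k ∘ f = id ∧ k ∘ g = id := by
  -- One copy lives on the even indices and the other on the odd ones; integer halving is a left
  -- inverse to both embeddings and so merges the copies.
  have hf : Function.Injective fun n : ℕ => 2 * n := fun a b h => by simpa using h
  have hg : Function.Injective fun n : ℕ => 2 * n + 1 := fun a b h => by simpa using h
  have h1 : ∀ n, (fun m => m / 2) ((fun n : ℕ => 2 * n) n) = n := fun n => by dsimp only; omega
  have h2 : ∀ n, (fun m => m / 2) ((fun n : ℕ => 2 * n + 1) n) = n :=
    fun n => by dsimp only; omega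
  exact ⟨L.map fun n => 2 * n, L.map fun n => 2 * n + 1, _, _, fun n => n / 2, hL.map hf,
    hL.map hg, hL.map_append_map hf hg (fun m n => by omega), Ctx.isRenaming_map ..,
    Ctx.isRenaming_map ..,
    Ctx.isRenaming_map_append_map L h1 h2, funext h1, funext h2⟩

/-- The pairing rule demands disjoint contexts. The premises are renamed into disjoint copies of
`L`, paired there, and the result is merged back; since the merging map inverts both embeddings, the
terms are unchanged. The next three lemmas use the same argument. -/
theorem ValTy.pair_contract {L : Ctx} {V W : Val} {A B : Ty} (hL : L.WF) (hV : ValTy L V A)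
    (hW : ValTy L W B) : ValTy L (.pair V W) (.tensor A B) := by
  obtain ⟨K, K', f, g, k, wK, wK', w, hf, hg, hk, ef, eg⟩ := hL.exists_split
  have := ValTy.ren k k hL hk (.pair w (.ren f f wK hf hV) (.ren g g wK' hg hW))
  simpa only [Val.ren, Val.ren_ren, ef, eg, Val.ren_id] using this

theorem CoValTy.pair_contract {L : Ctx} {S S' : CoVal} {A B : Ty} (hL : L.WF)
    (hS : CoValTy L S A) (hS' : CoValTy L S' B) : CoValTy L (.pair S S') (.par A B) := by
  obtain ⟨K, K', f, g, k, wK, wK', w, hf, hg, hk, ef, eg⟩ := hL.exists_split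
  have := CoValTy.ren k k hL hk (.pair w (.ren f f wK hf hS) (.ren g g wK' hg hS'))
  simpa only [CoVal.ren, CoVal.ren_ren, ef, eg, CoVal.ren_id] using this

theorem CmdTy.cutPos_contract {L : Ctx} {t : Tm} {S : CoVal} {A : Ty} {p : PosPol} (hL : L.WF)
    (hA : A.pol = p.toPol) (ht : TmTy L t A) (hS : CoValTy L S A) : CmdTy L (.cutPos p t S) := by
  obtain ⟨K, K', f, g, k, wK, wK', w, hf, hg, hk, ef, eg⟩ := hL.exists_split
  have := CmdTy.ren k k hL hk (.cutPos w hA (.ren f f wK hf ht) (.ren g g wK' hg hS))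
  simpa only [Cmd.ren, Tm.ren_ren, CoVal.ren_ren, ef, eg, Tm.ren_id, CoVal.ren_id] using this

theorem CmdTy.cutNeg_contract {L : Ctx} {V : Val} {e : Env} {A : Ty} (hL : L.WF)
    (hA : A.pol = .neg) (hV : ValTy L V A) (he : EnvTy L e A) : CmdTy L (.cutNeg V e) := by
  obtain ⟨K, K', f, g, k, wK, wK', w, hf, hg, hk, ef, eg⟩ := hL.exists_split
  have := CmdTy.ren k k hL hk (.cutNeg w hA (.ren f f wK hf hV) (.ren g g wK' hg he))
  simpa only [Cmd.ren, Val.ren_ren, Env.ren_ren, ef, eg, Val.ren_id, Env.ren_id] using this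

-- Substitution of closed values preserves typing

/-- `σ` sends each variable declared in `K` to a closed value or to a variable declared in the
same zone of `L`, and each covariable of `K` to a covariable of `L`. -/
structure Sub.IsClosing (σ : Sub) (K L : Ctx) : Prop where
  Γ : ∀ x A, (x, A) ∈ K.Γ →
    ValTy Ctx.empty (σ.var x) A ∨ ∃ y, σ.var x = .var y ∧ (y, A) ∈ L.Γ
  Θ : ∀ x A, (x, A) ∈ K.Θ →
    ValTy Ctx.empty (σ.var x) A ∨ ∃ y, σ.var x = .var y ∧ (y, A) ∈ L.Θ
  Δ : ∀ α A, (α, A) ∈ K.Δ → ∃ β, σ.covar α = .covar β ∧ (β, A) ∈ L.Δ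

namespace Sub.IsClosing

variable {σ : Sub} {K K' L : Ctx}

theorem upVar_aux {L M : List (ℕ × Ty)}
    (h : ∀ x A, (x, A) ∈ L → ValTy Ctx.empty (σ.var x) A ∨ ∃ y, σ.var x = .var y ∧ (y, A) ∈ M)
    (x : ℕ) (A : Ty) (hx : (x, A) ∈ Ctx.shift L) :
    ValTy Ctx.empty (σ.upVar.var x) A ∨ ∃ y, σ.upVar.var x = .var y ∧ (y, A) ∈ Ctx.shift M := by
  obtain ⟨z, rfl, hz⟩ := Ctx.mem_shift.1 hx
  rcases h z A hz with h | ⟨y, e, h⟩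
  · exact .inl (h.ren_of_empty ..)
  · exact .inr ⟨y + 1, congrArg (Val.ren Nat.succ _root_.id) e, Ctx.mem_shift.2 ⟨y, rfl, h⟩⟩

theorem upVar_zero {M : List (ℕ × Ty)} (A : Ty) :
    ∃ y, σ.upVar.var 0 = .var y ∧ (y, A) ∈ (0, A) :: M :=
  ⟨0, rfl, List.mem_cons_self⟩

theorem bindVar (h : σ.IsClosing K L) (A : Ty) :
    σ.upVar.IsClosing (K.bindVar A) (L.bindVar A) where
  Γ x B hx := by
    rcases List.mem_cons.1 hx with e | hx
    · cases e; exact .inr (upVar_zero A)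
    · exact (upVar_aux h.Γ x B hx).imp_right fun ⟨y, e, hy⟩ => ⟨y, e, List.mem_cons_of_mem _ hy⟩
  Θ := upVar_aux h.Θ
  Δ α B hα := by
    obtain ⟨β, e, hβ⟩ := h.Δ α B hα
    exact ⟨β, congrArg (CoVal.ren Nat.succ _root_.id) e, hβ⟩

theorem bindModal (h : σ.IsClosing K L) (A : Ty) :
    σ.upVar.IsClosing (K.bindModal A) (L.bindModal A) where
  Γ := upVar_aux h.Γ
  Θ x B hx := by
    rcases List.mem_cons.1 hx with e | hx
    · cases e; exact .inr (upVar_zero A)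
    · exact (upVar_aux h.Θ x B hx).imp_right fun ⟨y, e, hy⟩ => ⟨y, e, List.mem_cons_of_mem _ hy⟩
  Δ α B hα := by
    obtain ⟨β, e, hβ⟩ := h.Δ α B hα
    exact ⟨β, congrArg (CoVal.ren Nat.succ _root_.id) e, hβ⟩

theorem bindCovar (h : σ.IsClosing K L) (A : Ty) :
    σ.upCovar.IsClosing (K.bindCovar A) (L.bindCovar A) where
  Γ x B hx := (h.Γ x B hx).imp (fun h => h.ren_of_empty ..)
    fun ⟨y, e, hy⟩ => ⟨y, congrArg (Val.ren _root_.id Nat.succ) e, hy⟩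
  Θ x B hx := (h.Θ x B hx).imp (fun h => h.ren_of_empty ..)
    fun ⟨y, e, hy⟩ => ⟨y, congrArg (Val.ren _root_.id Nat.succ) e, hy⟩
  Δ α B hα := by
    rcases List.mem_cons.1 hα with e | hα
    · cases e; exact ⟨0, rfl, List.mem_cons_self⟩
    · obtain ⟨γ, rfl, hγ⟩ := Ctx.mem_shift.1 hα
      obtain ⟨β, e, hβ⟩ := h.Δ γ B hγ
      exact ⟨β + 1, congrArg (CoVal.ren _root_.id Nat.succ) e,
        List.mem_cons_of_mem _ (Ctx.mem_shift.2 ⟨β, rfl, hβ⟩)⟩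

theorem preRen {ρ κ : ℕ → ℕ} (h : σ.IsClosing K' L) (hr : Ctx.IsRenaming ρ κ K K') :
    (σ.preRen ρ κ).IsClosing K L :=
  ⟨fun x A hx => h.Γ _ A (hr.Γ x A hx), fun x A hx => h.Θ _ A (hr.Θ x A hx),
    fun α A hα => h.Δ _ A (hr.Δ α A hα)⟩

theorem left (h : σ.IsClosing (K.append K') L) : σ.IsClosing K L :=
  ⟨fun x A hx => h.Γ x A (List.mem_append_left _ hx),
    fun x A hx => h.Θ x A (List.mem_append_left _ hx),
    fun α A hα => h.Δ α A (List.mem_append_left _ hα)⟩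

theorem right (h : σ.IsClosing (K.append K') L) : σ.IsClosing K' L :=
  ⟨fun x A hx => h.Γ x A (List.mem_append_right _ hx),
    fun x A hx => h.Θ x A (List.mem_append_right _ hx),
    fun α A hα => h.Δ α A (List.mem_append_right _ hα)⟩

end Sub.IsClosing

/-- The part `(Γ_□ ¦ Θ ⊢ ⋄)` of a context. -/
def Ctx.modalPart (L : Ctx) : Ctx := ⟨L.Γ.filter fun p => p.2.pol = .box, L.Θ, []⟩

theorem Ctx.isModal_modalPart (L : Ctx) : L.modalPart.IsModal :=
  ⟨fun p hp => by simpa using (List.mem_filter.1 hp).2, rfl⟩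

theorem Ctx.WF.modalPart {L : Ctx} (h : L.WF) : L.modalPart.WF :=
  ⟨h.1.sublist ((List.filter_sublist.append_right _).map _), List.nodup_nil⟩

theorem Ctx.isRenaming_modalPart (L : Ctx) : Ctx.IsRenaming id id L.modalPart L :=
  Ctx.isRenaming_id List.filter_sublist.subset (List.Subset.refl _) (List.nil_subset _)

/-- Variables are sent to variables of the same type and zone, so those of a modal context can only
land in the modal part of the target. -/
theorem Sub.IsClosing.modalPart {σ : Sub} {K L : Ctx} (hK : K.IsModal) (h : σ.IsClosing K L) :
    σ.IsClosing K L.modalPart where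
  Γ x A hx := (h.Γ x A hx).imp_right fun ⟨y, e, hy⟩ =>
    ⟨y, e, List.mem_filter.2 ⟨hy, by simpa using hK.1 _ hx⟩⟩
  Θ := h.Θ
  Δ α A hα := by rw [hK.2] at hα; cases hα

-- Only closed values are substituted, besides renaming. This class of substitutions is stable under
-- binders and compatible with promotion, which an arbitrary typed substitution need not be. The
-- induction is on derivations, so the renaming rule is one more case, absorbed by precomposing `σ`.
mutual
theorem ValTy.subst_closing {K : Ctx} {V : Val} {A : Ty} (h : ValTy K V A) {σ : Sub} {L : Ctx}
    (hL : L.WF) (hσ : σ.IsClosing K L) : ValTy L (V.subst σ) A := by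
  match h with
  | .ax x A =>
    rcases hσ.Γ x A (List.mem_singleton.2 rfl) with h | ⟨y, e, hy⟩
    · exact h.weaken hL (Ctx.isRenaming_empty ..)
    · rw [Val.subst, e]
      exact (ValTy.ax y A).weaken hL (Ctx.isRenaming_id (by simpa using hy) (by simp) (by simp))
  | .boxAx x A =>
    rcases hσ.Θ x A (List.mem_singleton.2 rfl) with h | ⟨y, e, hy⟩
    · exact h.weaken hL (Ctx.isRenaming_empty ..)
    · rw [Val.subst, e]
      exact (ValTy.boxAx y A).weaken hL (Ctx.isRenaming_id (by simp) (by simpa using hy) (by simp))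
  | .muNeg hA hc => exact .muNeg hA (hc.subst_closing (hL.bindCovar _) (hσ.bindCovar _))
  | .unit => exact ValTy.unit.weaken hL (Ctx.isRenaming_empty ..)
  | .pair _ hV hW =>
    exact .pair_contract hL (hV.subst_closing hL hσ.left) (hW.subst_closing hL hσ.right)
  | .inl hV => exact .inl (hV.subst_closing hL hσ)
  | .inr hV => exact .inr (hV.subst_closing hL hσ)
  | .muPar hA hB hc =>
    exact .muPar hA hB (hc.subst_closing ((hL.bindCovar _).bindCovar _)
      ((hσ.bindCovar _).bindCovar _))
  | .muNot hA hc => exact .muNot hA (hc.subst_closing (hL.bindVar _) (hσ.bindVar _))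
  | .muRec hA hB hc₁ hc₂ =>
    exact .muRec hA hB (hc₁.subst_closing (hL.bindCovar _) (hσ.bindCovar _))
      (hc₂.subst_closing (hL.bindCovar _) (hσ.bindCovar _))
  | .box hK hV =>
    -- `L` need not be modal, so promotion is performed over its modal part and the result is
    -- weakened to `L`.
    exact (ValTy.box L.isModal_modalPart
      (hV.subst_closing hL.modalPart (hσ.modalPart hK))).weaken hL L.isRenaming_modalPart
  | .ren ρ κ _ hr hV =>
    rw [Val.ren_subst]
    exact hV.subst_closing hL (hσ.preRen hr)
termination_by structural h
theorem CoValTy.subst_closing {K : Ctx} {S : CoVal} {A : Ty} (h : CoValTy K S A) {σ : Sub}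
    {L : Ctx} (hL : L.WF) (hσ : σ.IsClosing K L) : CoValTy L (S.subst σ) A := by
  match h with
  | .ax α A =>
    obtain ⟨β, e, hβ⟩ := hσ.Δ α A (List.mem_singleton.2 rfl)
    rw [CoVal.subst, e]
    exact (CoValTy.ax β A).weaken hL (Ctx.isRenaming_id (by simp) (by simp) (by simpa using hβ))
  | .mutPos hA hc => exact .mutPos hA (hc.subst_closing (hL.bindVar _) (hσ.bindVar _))
  | .mutUnit hc => exact .mutUnit (hc.subst_closing hL hσ)
  | .mutPair hA hB hc =>
    exact .mutPair hA hB (hc.subst_closing ((hL.bindVar _).bindVar _) ((hσ.bindVar _).bindVar _))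
  | .mutCase hA hB hc₁ hc₂ =>
    exact .mutCase hA hB (hc₁.subst_closing (hL.bindVar _) (hσ.bindVar _))
      (hc₂.subst_closing (hL.bindVar _) (hσ.bindVar _))
  | .pair _ hS hS' =>
    exact .pair_contract hL (hS.subst_closing hL hσ.left) (hS'.subst_closing hL hσ.right)
  | .not hV => exact .not (hV.subst_closing hL hσ)
  | .fst hS => exact .fst (hS.subst_closing hL hσ)
  | .snd hS => exact .snd (hS.subst_closing hL hσ)
  | .mutBox hA hc => exact .mutBox hA (hc.subst_closing (hL.bindModal _) (hσ.bindModal _))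
  | .ren ρ κ _ hr hS =>
    rw [CoVal.ren_subst]
    exact hS.subst_closing hL (hσ.preRen hr)
termination_by structural h
theorem TmTy.subst_closing {K : Ctx} {t : Tm} {A : Ty} (h : TmTy K t A) {σ : Sub} {L : Ctx}
    (hL : L.WF) (hσ : σ.IsClosing K L) : TmTy L (t.subst σ) A := by
  match h with
  | .val hA hV => exact .val hA (hV.subst_closing hL hσ)
  | .muPos hA hc => exact .muPos hA (hc.subst_closing (hL.bindCovar _) (hσ.bindCovar _))
  | .ren ρ κ _ hr ht =>
    rw [Tm.ren_subst]
    exact ht.subst_closing hL (hσ.preRen hr)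
termination_by structural h
theorem EnvTy.subst_closing {K : Ctx} {e : Env} {A : Ty} (h : EnvTy K e A) {σ : Sub} {L : Ctx}
    (hL : L.WF) (hσ : σ.IsClosing K L) : EnvTy L (e.subst σ) A := by
  match h with
  | .coval hA hS => exact .coval hA (hS.subst_closing hL hσ)
  | .mutNeg hA hc => exact .mutNeg hA (hc.subst_closing (hL.bindVar _) (hσ.bindVar _))
  | .ren ρ κ _ hr he =>
    rw [Env.ren_subst]
    exact he.subst_closing hL (hσ.preRen hr)
termination_by structural h
theorem CmdTy.subst_closing {K : Ctx} {c : Cmd} (h : CmdTy K c) {σ : Sub} {L : Ctx}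
    (hL : L.WF) (hσ : σ.IsClosing K L) : CmdTy L (c.subst σ) := by
  match h with
  | .cutPos _ hA ht hS =>
    exact .cutPos_contract hL hA (ht.subst_closing hL hσ.left) (hS.subst_closing hL hσ.right)
  | .cutNeg _ hA hV he =>
    exact .cutNeg_contract hL hA (hV.subst_closing hL hσ.left) (he.subst_closing hL hσ.right)
  | .ren ρ κ _ hr hc =>
    rw [Cmd.ren_subst]
    exact hc.subst_closing hL (hσ.preRen hr)
termination_by structural h
end

-- The realizability interpretation of types

theorem PosPol.toPol_injective : Function.Injective PosPol.toPol := by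
  intro p q h
  cases p <;> cases q <;> first | rfl | cases h

theorem PosPol.toPol_ne_neg (p : PosPol) : p.toPol ≠ .neg := by
  cases p <;> exact Pol.noConfusion

theorem Pol.mul_ne_neg (ε ε' : Pol) : ε.mul ε' ≠ .neg := by
  cases ε <;> cases ε' <;> exact Pol.noConfusion

theorem Pol.mul_eq_box {ε ε' : Pol} (h : ε.mul ε' = .box) : ε = .box ∧ ε' = .box := by
  cases ε <;> cases ε' <;> first | exact ⟨rfl, rfl⟩ | cases h

/-- The interpretation of a positive type of polarity `ε` given by a set of values. -/
def posSem (P : Set Cmd) (ε : Pol) (X : Set Val) : Set Val × Set CoVal :=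
  (X, {S | ∀ p : PosPol, ε = p.toPol → ∀ V ∈ X, Cmd.cutPos p (.val V) S ∈ P})

/-- The interpretation of a negative type given by a set of co-values. -/
def negSem (P : Set Cmd) (Y : Set CoVal) : Set Val × Set CoVal :=
  ({V | ∀ S ∈ Y, Cmd.cutNeg V (.coval S) ∈ P}, Y)

/-- The sets of values and of co-values that realize a type, relative to a pole `P`. -/
def Ty.sem (P : Set Cmd) : Ty → Set Val × Set CoVal
  | .one => posSem P .box {.unit}
  | .tensor A B => posSem P (A.pol.mul B.pol)
      {U | ∃ V ∈ (A.sem P).1, ∃ W ∈ (B.sem P).1, U = .pair V W}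
  | .plus A B => posSem P (A.pol.mul B.pol)
      {U | (∃ V ∈ (A.sem P).1, U = .inl V) ∨ ∃ V ∈ (B.sem P).1, U = .inr V}
  | .box A => posSem P .box {U | ∃ V ∈ (A.sem P).1, ValTy Ctx.empty V A ∧ U = .box V}
  | .not A => negSem P {S | ∃ V ∈ (A.sem P).1, S = .not V}
  | .amp A B => negSem P {T | (∃ S ∈ (A.sem P).2, T = .fst S) ∨ ∃ S ∈ (B.sem P).2, T = .snd S}
  | .par A B => negSem P {T | ∃ S ∈ (A.sem P).2, ∃ S' ∈ (B.sem P).2, T = .pair S S'}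

/-- Uniform orthogonality for positive types: the cut annotation is forced by the polarity, so the
quantifier over annotations in `posSem` has the single instance `p`. It handles `μ̃x` and the
positive cut, where the shape of the type is unknown. -/
theorem Ty.mem_sem_snd_iff {P : Set Cmd} {A : Ty} {p : PosPol} (hA : A.pol = p.toPol)
    {S : CoVal} :
    S ∈ (A.sem P).2 ↔ ∀ V ∈ (A.sem P).1, Cmd.cutPos p (.val V) S ∈ P := by
  have key : ∀ X : Set Val, S ∈ (posSem P A.pol X).2 ↔ ∀ V ∈ X, Cmd.cutPos p (.val V) S ∈ P := by
    intro X
    refine ⟨fun h => h p hA, fun h q hq => ?_⟩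
    rwa [PosPol.toPol_injective (hq.symm.trans hA)]
  cases A with
  | one => exact key _
  | tensor A B => exact key _
  | plus A B => exact key _
  | box A => exact key _
  | not A => exact absurd hA.symm p.toPol_ne_neg
  | amp A B => exact absurd hA.symm p.toPol_ne_neg
  | par A B => exact absurd hA.symm p.toPol_ne_neg

theorem Ty.mem_sem_fst_iff {P : Set Cmd} {A : Ty} (hA : A.pol = .neg) {V : Val} :
    V ∈ (A.sem P).1 ↔ ∀ S ∈ (A.sem P).2, Cmd.cutNeg V (.coval S) ∈ P := by
  cases A with
  | one => cases hA
  | tensor A B => exact absurd hA (Pol.mul_ne_neg _ _)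
  | plus A B => exact absurd hA (Pol.mul_ne_neg _ _)
  | box A => cases hA
  | not A => exact Iff.rfl
  | amp A B => exact Iff.rfl
  | par A B => exact Iff.rfl

/-- Realizers of modal types are closed. -/
theorem ValTy.of_mem_sem {P : Set Cmd} {A : Ty} (hA : A.pol = .box) {V : Val}
    (hV : V ∈ (A.sem P).1) : ValTy Ctx.empty V A := by
  induction A generalizing V with
  | one => cases hV; exact .unit
  | tensor A B ihA ihB =>
    obtain ⟨V, hV, W, hW, rfl⟩ := hV
    -- A modal tensor has both components modal, so the induction hypothesis applies to each.
    obtain ⟨hA, hB⟩ := Pol.mul_eq_box hA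
    exact .pair_contract Ctx.empty_WF (ihA hA hV) (ihB hB hW)
  | plus A B ihA ihB =>
    obtain ⟨hA, hB⟩ := Pol.mul_eq_box hA
    rcases hV with ⟨V, hV, rfl⟩ | ⟨V, hV, rfl⟩
    · exact .inl (ihA hA hV)
    · exact .inr (ihB hB hV)
  | box A =>
    -- No induction hypothesis is available, as `A` may be non-modal; the typing of `V` is recorded
    -- in the interpretation of `□A`.
    obtain ⟨V, -, hV, rfl⟩ := hV
    exact .box ⟨by simp [Ctx.empty], rfl⟩ hV
  | not A => cases hA
  | amp A B => cases hA
  | par A B => cases hA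

-- Realizing substitutions

/-- `σ` sends the declarations of `K` to realizers of their types, closed ones in the modal
zone. -/
structure Sub.Realizes (P : Set Cmd) (σ : Sub) (K : Ctx) : Prop where
  Γ : ∀ x A, (x, A) ∈ K.Γ → σ.var x ∈ (A.sem P).1
  Θ : ∀ x A, (x, A) ∈ K.Θ → σ.var x ∈ (A.sem P).1 ∧ ValTy Ctx.empty (σ.var x) A
  Δ : ∀ α A, (α, A) ∈ K.Δ → σ.covar α ∈ (A.sem P).2

namespace Sub.Realizes

variable {P : Set Cmd} {σ : Sub} {K K' : Ctx} {A : Ty}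

theorem bindVar (h : σ.Realizes P K) {V : Val} (hV : V ∈ (A.sem P).1) :
    (σ.consVar V).Realizes P (K.bindVar A) where
  Γ x B hx := by
    rcases List.mem_cons.1 hx with e | hx
    · cases e; exact hV
    · obtain ⟨y, rfl, hy⟩ := Ctx.mem_shift.1 hx
      exact h.Γ y B hy
  Θ x B hx := by
    obtain ⟨y, rfl, hy⟩ := Ctx.mem_shift.1 hx
    exact h.Θ y B hy
  Δ := h.Δ

theorem bindModal (h : σ.Realizes P K) {V : Val} (hV : V ∈ (A.sem P).1)
    (hV' : ValTy Ctx.empty V A) : (σ.consVar V).Realizes P (K.bindModal A) where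
  Γ x B hx := by
    obtain ⟨y, rfl, hy⟩ := Ctx.mem_shift.1 hx
    exact h.Γ y B hy
  Θ x B hx := by
    rcases List.mem_cons.1 hx with e | hx
    · cases e; exact ⟨hV, hV'⟩
    · obtain ⟨y, rfl, hy⟩ := Ctx.mem_shift.1 hx
      exact h.Θ y B hy
  Δ := h.Δ

theorem bindCovar (h : σ.Realizes P K) {S : CoVal} (hS : S ∈ (A.sem P).2) :
    (σ.consCovar S).Realizes P (K.bindCovar A) where
  Γ := h.Γ
  Θ := h.Θ
  Δ α B hα := by
    rcases List.mem_cons.1 hα with e | hα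
    · cases e; exact hS
    · obtain ⟨β, rfl, hβ⟩ := Ctx.mem_shift.1 hα
      exact h.Δ β B hβ

theorem preRen {ρ κ : ℕ → ℕ} (h : σ.Realizes P K') (hr : Ctx.IsRenaming ρ κ K K') :
    (σ.preRen ρ κ).Realizes P K :=
  ⟨fun x A hx => h.Γ _ A (hr.Γ x A hx), fun x A hx => h.Θ _ A (hr.Θ x A hx),
    fun α A hα => h.Δ _ A (hr.Δ α A hα)⟩

theorem left (h : σ.Realizes P (K.append K')) : σ.Realizes P K :=
  ⟨fun x A hx => h.Γ x A (List.mem_append_left _ hx),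
    fun x A hx => h.Θ x A (List.mem_append_left _ hx),
    fun α A hα => h.Δ α A (List.mem_append_left _ hα)⟩

theorem right (h : σ.Realizes P (K.append K')) : σ.Realizes P K' :=
  ⟨fun x A hx => h.Γ x A (List.mem_append_right _ hx),
    fun x A hx => h.Θ x A (List.mem_append_right _ hx),
    fun α A hα => h.Δ α A (List.mem_append_right _ hα)⟩

/-- Ordinary variables of a modal context have modal types, whose realizers are closed; those in the
modal zone are closed by definition of `Sub.Realizes`; there are no covariables. -/
theorem isClosing (h : σ.Realizes P K) (hK : K.IsModal) : σ.IsClosing K Ctx.empty where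
  Γ x A hx := .inl (.of_mem_sem (hK.1 _ hx) (h.Γ x A hx))
  Θ x A hx := .inl (h.Θ x A hx).2
  Δ α A hα := by rw [hK.2] at hα; cases hα

end Sub.Realizes

-- Adequacy of the interpretation

/-- A set of commands closed under anti-reduction. -/
def IsPole (P : Set Cmd) : Prop := ∀ c c' : Cmd, Step c c' → c' ∈ P → c ∈ P

-- Induction on derivations. Constructors of data build realizers directly; for a `μ` or `μ̃`
-- binder, the cut against any realizer of the opposite side takes one step to its body under the
-- extended substitution, and the pole is closed under anti-reduction.
mutual
theorem ValTy.adequacy {P : Set Cmd} (hP : IsPole P) {K : Ctx} {V : Val} {A : Ty}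
    (h : ValTy K V A) {σ : Sub} (hσ : σ.Realizes P K) : V.subst σ ∈ (A.sem P).1 := by
  match h with
  | .ax x A => exact hσ.Γ x A (List.mem_singleton.2 rfl)
  | .boxAx x A => exact (hσ.Θ x A (List.mem_singleton.2 rfl)).1
  | .muNeg hA hc =>
    refine (Ty.mem_sem_fst_iff hA).2 fun S hS => hP _ _ (.muNeg _ S) ?_
    rw [Cmd.subst_upCovar_substCovar]
    exact hc.adequacy hP (hσ.bindCovar hS)
  | .unit => exact rfl
  | .pair _ hV hW => exact ⟨_, hV.adequacy hP hσ.left, _, hW.adequacy hP hσ.right, rfl⟩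
  | .inl hV => exact .inl ⟨_, hV.adequacy hP hσ, rfl⟩
  | .inr hV => exact .inr ⟨_, hV.adequacy hP hσ, rfl⟩
  | .muPar _ _ hc =>
    rintro _ ⟨S, hS, S', hS', rfl⟩
    refine hP _ _ (.par ..) ?_
    rw [Cmd.subst_upCovar_substCovar₂]
    exact hc.adequacy hP ((hσ.bindCovar hS).bindCovar hS')
  | .muNot _ hc =>
    rintro _ ⟨V, hV, rfl⟩
    refine hP _ _ (.not ..) ?_
    rw [Cmd.subst_upVar_substVar]
    exact hc.adequacy hP (hσ.bindVar hV)
  | .muRec _ _ hc₁ hc₂ =>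
    rintro _ (⟨S, hS, rfl⟩ | ⟨S, hS, rfl⟩)
    · refine hP _ _ (.fst ..) ?_
      rw [Cmd.subst_upCovar_substCovar]
      exact hc₁.adequacy hP (hσ.bindCovar hS)
    · refine hP _ _ (.snd ..) ?_
      rw [Cmd.subst_upCovar_substCovar]
      exact hc₂.adequacy hP (hσ.bindCovar hS)
  | .box hK hV =>
    -- The only use of the substitution lemma: the promoted value must be typed in the empty context
    -- as well as realize `A`.
    exact ⟨_, hV.adequacy hP hσ, hV.subst_closing Ctx.empty_WF (hσ.isClosing hK), rfl⟩
  | .ren ρ κ _ hr hV =>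
    rw [Val.ren_subst]
    exact hV.adequacy hP (hσ.preRen hr)
termination_by structural h
theorem CoValTy.adequacy {P : Set Cmd} (hP : IsPole P) {K : Ctx} {S : CoVal} {A : Ty}
    (h : CoValTy K S A) {σ : Sub} (hσ : σ.Realizes P K) : S.subst σ ∈ (A.sem P).2 := by
  match h with
  | .ax α A => exact hσ.Δ α A (List.mem_singleton.2 rfl)
  | .mutPos hA hc =>
    refine (Ty.mem_sem_snd_iff hA).2 fun V hV => hP _ _ (.mutPos _ V _) ?_
    rw [Cmd.subst_upVar_substVar]
    exact hc.adequacy hP (hσ.bindVar hV)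
  | .mutUnit hc =>
    refine (Ty.mem_sem_snd_iff (p := .box) rfl).2 ?_
    rintro _ rfl
    exact hP _ _ (.unit _) (hc.adequacy hP hσ)
  | .mutPair _ _ hc =>
    rintro p _ _ ⟨V, hV, W, hW, rfl⟩
    refine hP _ _ (.pair ..) ?_
    rw [Cmd.subst_upVar_substVar₂]
    exact hc.adequacy hP ((hσ.bindVar hV).bindVar hW)
  | .mutCase _ _ hc₁ hc₂ =>
    rintro p _ _ (⟨V, hV, rfl⟩ | ⟨V, hV, rfl⟩)
    · refine hP _ _ (.inl ..) ?_
      rw [Cmd.subst_upVar_substVar]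
      exact hc₁.adequacy hP (hσ.bindVar hV)
    · refine hP _ _ (.inr ..) ?_
      rw [Cmd.subst_upVar_substVar]
      exact hc₂.adequacy hP (hσ.bindVar hV)
  | .pair _ hS hS' => exact ⟨_, hS.adequacy hP hσ.left, _, hS'.adequacy hP hσ.right, rfl⟩
  | .not hV => exact ⟨_, hV.adequacy hP hσ, rfl⟩
  | .fst hS => exact .inl ⟨_, hS.adequacy hP hσ, rfl⟩
  | .snd hS => exact .inr ⟨_, hS.adequacy hP hσ, rfl⟩
  | .mutBox _ hc =>
    refine (Ty.mem_sem_snd_iff (p := .box) rfl).2 ?_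
    -- The closedness `hV'` stored in a realizer of `□A` is what permits binding `V` in the modal
    -- zone.
    rintro _ ⟨V, hV, hV', rfl⟩
    refine hP _ _ (.box ..) ?_
    rw [Cmd.subst_upVar_substVar]
    exact hc.adequacy hP (hσ.bindModal hV hV')
  | .ren ρ κ _ hr hS =>
    rw [CoVal.ren_subst]
    exact hS.adequacy hP (hσ.preRen hr)
termination_by structural h
theorem TmTy.adequacy {P : Set Cmd} (hP : IsPole P) {K : Ctx} {t : Tm} {A : Ty}
    (h : TmTy K t A) {σ : Sub} (hσ : σ.Realizes P K) {p : PosPol} (hp : A.pol = p.toPol)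
    {S : CoVal} (hS : S ∈ (A.sem P).2) : Cmd.cutPos p (t.subst σ) S ∈ P := by
  match h with
  | .val _ hV => exact (Ty.mem_sem_snd_iff hp).1 hS _ (hV.adequacy hP hσ)
  | .muPos hA hc =>
    -- The annotations of the cut and of the `μ` both equal the polarity of `A`, as the reduction
    -- rule requires.
    rw [PosPol.toPol_injective (hp.symm.trans hA)]
    refine hP _ _ (.muPos _ _ S) ?_
    rw [Cmd.subst_upCovar_substCovar]
    exact hc.adequacy hP (hσ.bindCovar hS)
  | .ren ρ κ _ hr ht =>
    rw [Tm.ren_subst]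
    exact ht.adequacy hP (hσ.preRen hr) hp hS
termination_by structural h
theorem EnvTy.adequacy {P : Set Cmd} (hP : IsPole P) {K : Ctx} {e : Env} {A : Ty}
    (h : EnvTy K e A) {σ : Sub} (hσ : σ.Realizes P K) {V : Val} (hV : V ∈ (A.sem P).1) :
    Cmd.cutNeg V (e.subst σ) ∈ P := by
  match h with
  | .coval hA hS => exact (Ty.mem_sem_fst_iff hA).1 hV _ (hS.adequacy hP hσ)
  | .mutNeg _ hc =>
    refine hP _ _ (.mutNeg V _) ?_
    rw [Cmd.subst_upVar_substVar]
    exact hc.adequacy hP (hσ.bindVar hV)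
  | .ren ρ κ _ hr he =>
    rw [Env.ren_subst]
    exact he.adequacy hP (hσ.preRen hr) hV
termination_by structural h
theorem CmdTy.adequacy {P : Set Cmd} (hP : IsPole P) {K : Ctx} {c : Cmd}
    (h : CmdTy K c) {σ : Sub} (hσ : σ.Realizes P K) : c.subst σ ∈ P := by
  match h with
  | .cutPos _ hA ht hS => exact ht.adequacy hP hσ.left hA (hS.adequacy hP hσ.right)
  | .cutNeg _ _ hV he => exact he.adequacy hP hσ.right (hV.adequacy hP hσ.left)
  | .ren ρ κ _ hr hc =>
    rw [Cmd.ren_subst]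
    exact hc.adequacy hP (hσ.preRen hr)
termination_by structural h
end

-- Determinism and the evaluation pole

/-- There are no critical pairs: in a positive cut, `μα` takes priority because the other rules
require a value on the left; in a negative cut, `μ̃x` takes priority because the other rules require
a co-value on the right. -/
theorem Step.deterministic {c c₁ c₂ : Cmd} (h₁ : Step c c₁) (h₂ : Step c c₂) : c₁ = c₂ := by
  cases h₁ <;> cases h₂ <;> rfl

theorem Step.not_cutPos_covar {p : PosPol} {V : Val} {α : ℕ} {c : Cmd} :
    ¬ Step (.cutPos p (.val V) (.covar α)) c := by
  intro h
  cases h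

theorem Steps.eq_of_normal {c d d' : Cmd} (h : Steps c d) (h' : Steps c d')
    (hd : ∀ e, ¬ Step d e) (hd' : ∀ e, ¬ Step d' e) : d = d' := by
  induction h using Relation.ReflTransGen.head_induction_on with
  | refl =>
    rcases h'.cases_head with e | ⟨e, he, -⟩
    · exact e
    · exact absurd he (hd e)
  | head h₁ _ ih =>
    rcases h'.cases_head with rfl | ⟨e, he, h'⟩
    · exact absurd h₁ (hd' _)
    · exact ih (h₁.deterministic he ▸ h')

/-- The commands that evaluate to a closed value of type `R` on the covariable `tp`. -/
def evalPole (tp : ℕ) (R : Ty) : Set Cmd :=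
  {c | ∃ V, ValTy Ctx.empty V R ∧ Steps c (.cutPos .box (.val V) (.covar tp))}

theorem isPole_evalPole (tp : ℕ) (R : Ty) : IsPole (evalPole tp R) :=
  fun _ _ h ⟨V, hV, hs⟩ => ⟨V, hV, .head h hs⟩

/-- This is where modality of `R` matters: its realizers are closed values of type `R`, so cutting
one against `tp` is already a final state of the pole. -/
theorem covar_mem_sem_evalPole (tp : ℕ) {R : Ty} (hR : R.pol = .box) :
    CoVal.covar tp ∈ (R.sem (evalPole tp R)).2 :=
  (Ty.mem_sem_snd_iff (p := .box) hR).2 fun V hV => ⟨V, .of_mem_sem hR hV, .refl⟩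

theorem realizes_id (tp : ℕ) {R : Ty} (hR : R.pol = .box) :
    Sub.id.Realizes (evalPole tp R) ⟨[], [], [(tp, R)]⟩ where
  Γ _ _ h := by cases h
  Θ _ _ h := by cases h
  Δ α A h := by
    cases List.mem_singleton.1 h
    exact covar_mem_sem_evalPole tp hR

end LBox

theorem mainTheorem1 (tp : ℕ) (R : LBox.Ty) (hR : R.pol = LBox.Pol.box) (c : LBox.Cmd)
    (hc : LBox.CmdTy ⟨[], [], [(tp, R)]⟩ c) :
    ∃ V : LBox.Val, LBox.ValTy ⟨[], [], []⟩ V R ∧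
      LBox.Steps c (.cutPos .box (.val V) (.covar tp)) ∧
      ∀ V' : LBox.Val, LBox.Steps c (.cutPos .box (.val V') (.covar tp)) → V' = V := by
  have h := hc.adequacy (LBox.isPole_evalPole tp R) (LBox.realizes_id tp hR)
  rw [LBox.Cmd.subst_id] at h
  obtain ⟨V, hV, hs⟩ := h
  refine ⟨V, hV, hs, fun V' hs' => ?_⟩
  have e := hs'.eq_of_normal hs (fun _ => LBox.Step.not_cutPos_covar)
    fun _ => LBox.Step.not_cutPos_covar
  cases e
  rfl
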